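/- Let $T$ be a complete first-order theory and let $\bar M$ be a monster model of $T$, i.e. $\bar M$ is $\kappa$-saturated and strongly $\kappa$-homogeneous for some uncountable cardinal $\kappa$; a subset of $\bar M$ is called small if it has fewer than $\kappa$ elements. A global type $\mathfrak p(x)$ (in a finite tuple $x$ of variables) is a complete type over $\bar M$, and $\mathfrak p_{\upharpoonright A}$ denotes the set of formulas in $\mathfrak p$ with parameters in $A$. It is non-algebraic if no formula in it has only finitely many solutions in $\bar M$, and it is $A$-invariant if $\phi(x,\bar b_1)\in\mathfrak p\Leftrightarrow\phi(x,\bar b_2)\in\mathfrak p$ for every formula $\phi(x,\bar y)$ over $A$ and all finite tuples $\bar b_1,\bar b_2$ of $\bar M$ with $\mathrm{tp}(\bar b_1/A)=\mathrm{tp}(\bar b_2/A)$. A sequence $(a_i\mid i<\alpha)$ in $\bar M$, where $\alpha$ is an ordinal, is a Morley sequence in $\mathfrak p$ over $A$ if $a_i\models\mathfrak p_{\upharpoonright A\cup\{a_j\mid j<i\}}$ for all $i<\alpha$. A global type $\mathfrak p$ is generically stable if it is non-algebraic and there is a small set $A_0$ such that $\mathfrak p$ is $A_0$-invariant and, for every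 infinite ordinal $\alpha$, every Morley sequence $(a_i\mid i<\alpha)$ in $\mathfrak p$ over $A_0$ and every formula $\phi(x)$ with parameters from $\bar M$, the set $\{i<\alpha\mid\ \models\phi(a_i)\}$ is finite or cofinite in $\alpha$. For a small set $A$, $\mathfrak p$ is regular over $A$ if it is non-algebraic, $A$-invariant, and for every small $B\supseteq A$ and every $a\models\mathfrak p_{\upharpoonright A}$, either $a\models\mathfrak p_{\upharpoonright B}$ or $\mathfrak p_{\upharpoonright B}\vdash\mathfrak p_{\upharpoonright Ba}$ (every realization of $\mathfrak p_{\upharpoonright B}$ in $\bar M$ realizes $\mathfrak p_{\upharpoonright Ba}$). The type $\mathfrak p_{\upharpoonright A}$ is isolated if it contains a formula $\theta(x)$ that implies in $\bar M$ every formula of $\mathfrak p_{\upharpoonright A}$. Let $A\subseteq\bar M$ be small and let $\mathfrak p$ be a global type that is generically stable and regular over $A$. If $\mathfrak p_{\upharpoonright A}$ is non-isolated, then $\mathfrak p_{\upharpoonright B}$ is non-isolated for every small $B\supseteq A$. -/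

import Mathlib

open FirstOrder Cardinal

universe u v w

namespace FirstOrder.Language

/-- `M` is a monster model of its complete theory, relative to the uncountable cardinal `κ`:
it is `κ`-saturated and strongly `κ`-homogeneous. A subset of `M` is *small* if it has fewer than
`κ` elements. -/
structure IsMonster (L : Language.{u, v}) (M : Type w) [L.Structure M] (κ : Cardinal.{w}) :
    Prop where
  aleph0_lt : ℵ₀ < κ
  /-- Every finitely satisfiable set of formulas in finitely many variables over a small set
  is satisfied by a tuple of `M`. -/
  saturated : ∀ (A : Set M), #A < κ → ∀ (k : ℕ) (S : Set (L[[A]].Formula (Fin k))),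
    (∀ S₀ ⊆ S, S₀.Finite → ∃ a : Fin k → M, ∀ φ ∈ S₀, φ.Realize a) →
      ∃ a : Fin k → M, ∀ φ ∈ S, φ.Realize a
  /-- Every elementary map from a small subset of `M` to `M` extends to an automorphism. -/
  homogeneous : ∀ (A : Set M), #A < κ → ∀ f : A → M,
    (∀ φ : L.Formula A, φ.Realize (fun a : A => (a : M)) ↔ φ.Realize f) →
      ∃ σ : M ≃[L] M, ∀ a : A, σ a = f a

/-- A global `n`-type: a complete type in `n` variables over the whole of `M`. -/
abbrev GlobalType (L : Language.{u, v}) (M : Type w) [L.Structure M] (n : ℕ) :=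
  (L.elementaryDiagram M).CompleteType (Fin n)

section

variable {L : Language.{u, v}} {M : Type w} [L.Structure M] {n m : ℕ}

/-- A formula with parameters in `A`, regarded as a formula with parameters in `M`. -/
def liftParams {A : Set M} {α : Type} (φ : L[[A]].Formula α) : L[[M]].Formula α :=
  (L.lhomWithConstantsMap (fun a : A => (a : M))).onFormula φ

/-- For a formula `φ(x, y)` over `A` and a tuple `b` of `M`, the formula `φ(x, b)`. -/
def instParams {A : Set M} (φ : L[[A]].Formula (Fin n ⊕ Fin m)) (b : Fin m → M) :
    L[[M]].Formula (Fin n) :=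
  BoundedFormula.subst (liftParams φ)
    (Sum.elim (fun i => Term.var i) (fun j => (L.con (b j)).term))

/-- `a ≡ b (A)`: the tuples `a` and `b` have the same type over `A`. -/
def SameTypeOver (A : Set M) (a b : Fin m → M) : Prop :=
  ∀ ψ : L[[A]].Formula (Fin m), ψ.Realize a ↔ ψ.Realize b

/-- The tuple `a` realizes the set `q` of formulas over `A`. -/
def Realizes {A : Set M} (a : Fin n → M) (q : Set (L[[A]].Formula (Fin n))) : Prop :=
  ∀ φ ∈ q, φ.Realize a

/-- The set `q` of formulas over `A` is isolated: some formula of `q` implies all of `q`. -/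
def IsIsolatedType {A : Set M} (q : Set (L[[A]].Formula (Fin n))) : Prop :=
  ∃ θ ∈ q, ∀ φ ∈ q, ∀ a : Fin n → M, θ.Realize a → φ.Realize a

namespace GlobalType

/-- The formula `φ(x)`, with parameters in `M`, belongs to the global type `p(x)`. -/
def Contains (p : GlobalType L M n) (φ : L[[M]].Formula (Fin n)) : Prop :=
  Formula.equivSentence φ ∈ p

/-- The restriction of `p` to `A`: the set of formulas over `A` that belong to `p`. -/
def restrict (p : GlobalType L M n) (A : Set M) : Set (L[[A]].Formula (Fin n)) :=
  {φ | p.Contains (liftParams φ)}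

/-- No formula of `p` has only finitely many solutions. -/
def IsNonalgebraic (p : GlobalType L M n) : Prop :=
  ∀ φ : L[[M]].Formula (Fin n), p.Contains φ → {a : Fin n → M | φ.Realize a}.Infinite

/-- `p` is `A`-invariant: `φ(x, b₁) ∈ p ↔ φ(x, b₂) ∈ p` whenever `b₁ ≡ b₂ (A)`. -/
def IsInvariantOver (p : GlobalType L M n) (A : Set M) : Prop :=
  ∀ (m : ℕ) (φ : L[[A]].Formula (Fin n ⊕ Fin m)) (b₁ b₂ : Fin m → M),
    SameTypeOver (L := L) A b₁ b₂ → (p.Contains (instParams φ b₁) ↔ p.Contains (instParams φ b₂))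

/-- `(a i | i < α)` is a Morley sequence in `p` over `A`: each `a i` realizes the restriction
of `p` to `A` together with the entries of all `a j`, `j < i`. Only the values `a i` for `i < α`
matter. -/
def IsMorleySequence (p : GlobalType L M n) (A : Set M) (α : Ordinal.{w})
    (a : Ordinal.{w} → Fin n → M) : Prop :=
  ∀ i < α, Realizes (a i) (p.restrict (A ∪ {x | ∃ j < i, x ∈ Set.range (a j)}))

/-- `p` is generically stable: it is non-algebraic and, for some small `A`, it is `A`-invariant
and every formula over `M` holds at finitely many or at all but finitely many members of any
infinite Morley sequence in `p` over `A`. -/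
def IsGenericallyStable (κ : Cardinal.{w}) (p : GlobalType L M n) : Prop :=
  p.IsNonalgebraic ∧ ∃ A : Set M, #A < κ ∧ p.IsInvariantOver A ∧
    ∀ (α : Ordinal.{w}), Ordinal.omega0 ≤ α → ∀ a : Ordinal.{w} → Fin n → M,
      p.IsMorleySequence A α a → ∀ φ : L[[M]].Formula (Fin n),
        {i | i < α ∧ φ.Realize (a i)}.Finite ∨ {i | i < α ∧ ¬ φ.Realize (a i)}.Finite

/-- `p` is regular over `A`: it is non-algebraic, `A`-invariant, and for every small `B ⊇ A` and
every realization `a` of `p` restricted to `A`, either `a` realizes `p` restricted to `B`, or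
`p` restricted to `B` implies `p` restricted to `B ∪ a`. -/
def IsRegularOver (κ : Cardinal.{w}) (p : GlobalType L M n) (A : Set M) : Prop :=
  p.IsNonalgebraic ∧ p.IsInvariantOver A ∧
    ∀ B : Set M, A ⊆ B → #B < κ → ∀ a : Fin n → M, Realizes a (p.restrict A) →
      Realizes a (p.restrict B) ∨
        ∀ c : Fin n → M, Realizes c (p.restrict B) → Realizes c (p.restrict (B ∪ Set.range a))

end GlobalType

end

end FirstOrder.Language

/-! Suppose `S` isolates `p` over `B` while `p` is non-isolated over `A`. One builds a Morley
sequence over `A` lying wholly outside `S`, although `S` is large for `p`; generic stability forbids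
this (`IsMorley.exists_mem`).

Let `X` be `A` together with the terms found so far. The induction keeps `p` non-isolated over `X`
and keeps every realization of `p` over `B` a realization over `B ∪ X`. If some large `X`-definable
`Q` were inside `S`, its points would be generic over `B`, hence over `X`, and `Q` would isolate `p`
over `X`. So saturation gives a next term `a`, generic over `X` and outside `S`. As `a` is not
generic over `B ∪ X`, regularity yields the second invariant for `X ∪ a`. The first is
`IsIsolatedOver.of_union_range`, which rests on the symmetry of generically stable types: isolation
over `X ∪ a` would descend to `X`.

Both uses of stability go through `IsStableOver.large_of_forall_mem`: a definable set containing a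
whole Morley sequence is large. -/

namespace FirstOrder.Language

/-! ### From formulas of a global type to large definable sets -/

section

variable {L : Language.{u, v}} {M : Type w} [L.Structure M] {n m : ℕ}

theorem realize_liftParams {A : Set M} {α : Type} (φ : L[[A]].Formula α) (a : α → M) :
    (liftParams φ).Realize a ↔ φ.Realize a := by
  have : (LHom.constantsOnMap (fun a : A => (a : M))).IsExpansionOn M :=
    constantsOnMap_isExpansionOn rfl
  have : (L.lhomWithConstantsMap (fun a : A => (a : M))).IsExpansionOn M :=
    LHom.sumMap_isExpansionOn _ _ _
  exact LHom.realize_onFormula _ _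

theorem realize_instParams {A : Set M} (φ : L[[A]].Formula (Fin n ⊕ Fin m)) (b : Fin m → M)
    (a : Fin n → M) : (instParams φ b).Realize a ↔ φ.Realize (Sum.elim a b) := by
  rw [← realize_liftParams, instParams, Formula.Realize, BoundedFormula.realize_subst]
  have : (fun i => ((Sum.elim (fun i => Term.var i) (fun j => (L.con (b j)).term) :
      Fin n ⊕ Fin m → L[[M]].Term (Fin n)) i).realize a) = Sum.elim a b := by
    funext i
    cases i <;> simp [Term.realize_constants]
    rfl
  rw [this]
  rfl

namespace GlobalType

/-- The universal closure of `φ → ψ` holds in `M`, so it belongs to the elementary diagram that `p`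
extends. -/
theorem Contains.mono [Nonempty M] {p : GlobalType L M n} {φ ψ : L[[M]].Formula (Fin n)}
    (hφ : p.Contains φ) (h : ∀ a : Fin n → M, φ.Realize a → ψ.Realize a) : p.Contains ψ := by
  have key : (L.elementaryDiagram M) ⊨ᵇ (φ.imp ψ : L[[M]].Formula (Fin n)) := by
    have hs : (Formula.iAlls (Fin n) ((φ.imp ψ : L[[M]].Formula (Fin n)).relabel Sum.inr) :
        L[[M]].Formula Empty) ∈ L.elementaryDiagram M := by
      rw [elementaryDiagram, mem_completeTheory, Sentence.Realize, Formula.realize_iAlls]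
      intro i
      rw [Formula.realize_relabel]
      exact h _
    intro N v xs
    have := Theory.realize_sentence_of_mem (M := N) _ hs
    rw [Sentence.Realize, Formula.realize_iAlls] at this
    have := this v
    rw [Formula.realize_relabel] at this
    rw [Unique.eq_default xs]
    exact this
  rw [Theory.models_formula_iff_onTheory_models_equivSentence] at key
  have key := p.mem_of_models key
  unfold Contains at *
  rw [← SetLike.mem_coe, p.isMaximal.mem_iff_models, Theory.models_sentence_iff] at *
  intro N
  exact (key N) (hφ N)

theorem contains_not {p : GlobalType L M n} {φ : L[[M]].Formula (Fin n)} :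
    p.Contains φ.not ↔ ¬ p.Contains φ := by
  rw [Contains, Formula.equivSentence_not, Theory.CompleteType.not_mem_iff]
  rfl

theorem contains_inf {p : GlobalType L M n} {φ ψ : L[[M]].Formula (Fin n)}
    (hφ : p.Contains φ) (hψ : p.Contains ψ) : p.Contains (φ ⊓ ψ) := by
  rw [Contains, Formula.equivSentence_inf]
  unfold Contains at *
  rw [← SetLike.mem_coe, p.isMaximal.mem_iff_models, Theory.models_sentence_iff] at *
  intro N
  exact BoundedFormula.realize_inf.2 ⟨hφ N, hψ N⟩

/-- A set of tuples is large for `p` if it is defined by a formula of `p`. -/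
def Large (p : GlobalType L M n) (S : Set (Fin n → M)) : Prop :=
  ∃ φ : L[[M]].Formula (Fin n), p.Contains φ ∧ S = Set.ofPred φ.Realize

theorem large_iff_contains [Nonempty M] {p : GlobalType L M n} {S : Set (Fin n → M)}
    {φ : L[[M]].Formula (Fin n)} (h : ∀ a, a ∈ S ↔ φ.Realize a) : p.Large S ↔ p.Contains φ := by
  constructor
  · rintro ⟨ψ, hψ, rfl⟩
    exact hψ.mono fun a ha => (h a).1 ha
  · intro hφ
    exact ⟨φ, hφ, Set.ext h⟩

end GlobalType

theorem exists_formula_of_definable {A : Set M} {S : Set (Fin n → M)} (hS : A.Definable L S) :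
    ∃ φ : L[[M]].Formula (Fin n), ∀ a, a ∈ S ↔ φ.Realize a := by
  obtain ⟨φ, rfl⟩ := hS
  exact ⟨liftParams φ, fun a => (realize_liftParams φ a).symm⟩

namespace GlobalType

variable {p : GlobalType L M n} {A B : Set M} {S T : Set (Fin n → M)}

theorem Large.inter (hS : p.Large S) (hT : p.Large T) : p.Large (S ∩ T) := by
  obtain ⟨φ, hφ, rfl⟩ := hS
  obtain ⟨ψ, hψ, rfl⟩ := hT
  refine ⟨φ ⊓ ψ, contains_inf hφ hψ, ?_⟩
  ext a
  exact Formula.realize_inf.symm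

/-- The tuple `a` realizes the restriction of `p` to `A`. -/
def Generic (p : GlobalType L M n) (A : Set M) (a : Fin n → M) : Prop :=
  ∀ S, A.Definable L S → p.Large S → a ∈ S

theorem Generic.mono {a : Fin n → M} (h : p.Generic B a) (hAB : A ⊆ B) : p.Generic A a :=
  fun S hS => h S (hS.mono hAB)

variable [Nonempty M]

theorem Large.mono (hS : p.Large S) (hT : A.Definable L T) (h : S ⊆ T) : p.Large T := by
  obtain ⟨φ, hφ, rfl⟩ := hS
  obtain ⟨ψ, hψ⟩ := exists_formula_of_definable hT
  exact (large_iff_contains hψ).2 (hφ.mono fun a ha => (hψ a).1 (h ha))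

theorem large_compl (hS : A.Definable L S) : p.Large Sᶜ ↔ ¬ p.Large S := by
  obtain ⟨φ, hφ⟩ := exists_formula_of_definable hS
  rw [large_iff_contains hφ, ← contains_not]
  refine large_iff_contains fun a => ?_
  rw [Formula.realize_not, ← hφ, Set.mem_compl_iff]

theorem large_univ : p.Large (Set.univ : Set (Fin n → M)) := by
  by_contra h
  have h' : p.Large (∅ : Set (Fin n → M)) := by
    rw [← Set.compl_univ]
    exact (large_compl (A := ∅) Set.definable_univ).2 h
  exact h (h'.mono (A := ∅) Set.definable_univ (Set.empty_subset _))

theorem Large.nonempty (hS : p.Large S) : S.Nonempty := by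
  rw [Set.nonempty_iff_ne_empty]
  rintro rfl
  have := (large_compl (p := p) (A := ∅) (S := (∅ : Set (Fin n → M))) Set.definable_empty).1
    (by rw [Set.compl_empty]; exact large_univ)
  exact this hS

theorem realizes_restrict_iff {a : Fin n → M} : Realizes a (p.restrict A) ↔ p.Generic A a := by
  constructor
  · rintro h _ ⟨φ, rfl⟩ hS
    refine h φ ?_
    exact (large_iff_contains fun a => (realize_liftParams φ a).symm).1 hS
  · intro h φ hφ
    refine h (Set.ofPred φ.Realize) ⟨φ, rfl⟩ ?_
    exact (large_iff_contains fun a => (realize_liftParams φ a).symm).2 hφ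

theorem isIsolatedType_restrict_iff : IsIsolatedType (p.restrict A) ↔
    ∃ S, A.Definable L S ∧ p.Large S ∧ ∀ a ∈ S, p.Generic A a := by
  constructor
  · rintro ⟨θ, hθ, h⟩
    refine ⟨Set.ofPred θ.Realize, ⟨θ, rfl⟩,
      (large_iff_contains fun a => (realize_liftParams θ a).symm).2 hθ, fun a ha => ?_⟩
    rw [← realizes_restrict_iff]
    exact fun φ hφ => h φ hφ a ha
  · rintro ⟨_, ⟨θ, rfl⟩, hS, h⟩
    refine ⟨θ, (large_iff_contains fun a => (realize_liftParams θ a).symm).1 hS,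
      fun φ hφ a ha => ?_⟩
    exact realizes_restrict_iff.2 (h a ha) φ hφ

theorem Generic.mem_iff {a : Fin n → M} (h : p.Generic A a) (hS : A.Definable L S) :
    a ∈ S ↔ p.Large S := by
  refine ⟨fun ha => ?_, h S hS⟩
  by_contra hn
  exact h _ hS.compl ((large_compl hS).2 hn) ha

end GlobalType

/-! ### Invariance, and parameters as fibres of definable sets -/

/-- The tuples `s` and `t` lie in the same `A`-definable sets. -/
def SameDefinable (L : Language.{u, v}) {M : Type w} [L.Structure M] (A : Set M) {ι : Type}
    (s t : ι → M) : Prop :=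
  ∀ S : Set (ι → M), A.Definable L S → (s ∈ S ↔ t ∈ S)

theorem GlobalType.IsInvariantOver.large_iff [Nonempty M] {p : GlobalType L M n} {A : Set M}
    (hp : p.IsInvariantOver A) {ι : Type} [Finite ι] {S : Set (Fin n ⊕ ι → M)}
    (hS : A.Definable L S) {s t : ι → M} (h : SameDefinable L A s t) :
    p.Large {x | Sum.elim x s ∈ S} ↔ p.Large {x | Sum.elim x t ∈ S} := by
  cases nonempty_fintype ι
  let e := Fintype.equivFin ι
  obtain ⟨φ, hφ⟩ := hS.preimage_comp (Sum.map id e)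
  have key (r : ι → M) : p.Large {x | Sum.elim x r ∈ S} ↔
      p.Contains (instParams φ (r ∘ e.symm)) := by
    refine large_iff_contains fun a => ?_
    rw [realize_instParams]
    have := Set.ext_iff.1 hφ (Sum.elim a (r ∘ e.symm))
    have h2 : Sum.elim a (r ∘ e.symm) ∘ Sum.map id e = Sum.elim a r := by
      funext i; cases i <;> simp
    rw [Set.mem_preimage, h2] at this
    exact this
  rw [key, key]
  refine hp _ φ _ _ fun ψ => ?_
  exact h {x | ψ.Realize (x ∘ e.symm)}
    ((show A.Definable L (Set.ofPred ψ.Realize) from ⟨ψ, rfl⟩).preimage_comp e.symm)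

/-- A set definable over `A` together with the entries of a tuple `b` is a fibre over `b` of an
`A`-definable set. -/
theorem exists_definable_fibre {A : Set M} {α ι : Type} {b : ι → M} {S : Set (α → M)}
    (hS : (A ∪ Set.range b).Definable L S) :
    ∃ T : Set (α ⊕ ι → M), A.Definable L T ∧ S = {x | Sum.elim x b ∈ T} := by
  classical
  obtain ⟨φ, rfl⟩ := Set.definable_iff_exists_formula_sum.1 hS
  have hc (x : (A ∪ Set.range b : Set M)) (hx : (x : M) ∉ A) : ∃ i, b i = x :=
    x.2.resolve_left hx
  let g : (A ∪ Set.range b : Set M) ⊕ α → A ⊕ (α ⊕ ι) := Sum.elim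
    (fun x => if hx : (x : M) ∈ A then Sum.inl ⟨x, hx⟩ else Sum.inr (Sum.inr (hc x hx).choose))
    (fun i => Sum.inr (Sum.inl i))
  refine ⟨_, Set.definable_iff_exists_formula_sum.2 ⟨φ.relabel g, rfl⟩, ?_⟩
  ext v
  change _ ↔ (φ.relabel g).Realize _
  rw [Formula.realize_relabel]
  refine iff_of_eq (congrArg φ.Realize ?_)
  funext i
  rcases i with x | i
  · by_cases hx : (x : M) ∈ A
    · simp [g, hx]
    · simp only [g, Sum.elim_inl, Function.comp, hx, dite_false, Sum.elim_inr]
      exact (hc x hx).choose_spec.symm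
  · simp [g]

theorem definable_fibre {A : Set M} {α ι : Type} (b : ι → M) {T : Set (α ⊕ ι → M)}
    (hT : A.Definable L T) : (A ∪ Set.range b).Definable L {x : α → M | Sum.elim x b ∈ T} := by
  obtain ⟨φ, rfl⟩ := Set.definable_iff_exists_formula_sum.1 hT
  let g : A ⊕ (α ⊕ ι) → (A ∪ Set.range b : Set M) ⊕ α := Sum.elim
    (fun x => Sum.inl ⟨x, Or.inl x.2⟩)
    (Sum.elim Sum.inr (fun i => Sum.inl ⟨b i, Or.inr ⟨i, rfl⟩⟩))
  refine Set.definable_iff_exists_formula_sum.2 ⟨φ.relabel g, ?_⟩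
  ext v
  change φ.Realize _ ↔ (φ.relabel g).Realize _
  rw [Formula.realize_relabel]
  refine iff_of_eq (congrArg φ.Realize ?_)
  funext i
  rcases i with x | i | i <;> rfl

/-- A `B`-definable set is a fibre of an `A`-definable set over a finite tuple of `B`. -/
theorem exists_definable_fibre_fin (A : Set M) {B : Set M} {α : Type} {S : Set (α → M)}
    (hS : B.Definable L S) : ∃ (k : ℕ) (d : Fin k → M), Set.range d ⊆ B ∧
      ∃ T : Set (α ⊕ Fin k → M), A.Definable L T ∧ S = {x | Sum.elim x d ∈ T} := by
  obtain ⟨B₀, hB₀, hS⟩ := Set.definable_iff_finitely_definable.1 hS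
  have hr : Set.range (fun i => (B₀.equivFin.symm i : M)) = B₀ := by
    ext x
    constructor
    · rintro ⟨i, rfl⟩
      exact (B₀.equivFin.symm i).2
    · intro hx
      exact ⟨B₀.equivFin ⟨x, hx⟩, by simp⟩
  refine ⟨_, fun i => (B₀.equivFin.symm i : M), hr ▸ hB₀, exists_definable_fibre ?_⟩
  rw [hr]
  exact hS.mono Set.subset_union_right

theorem SameDefinable.sumElim {A B : Set M} (hAB : A ⊆ B) {ι κ : Type} {s t : ι → M} {d : κ → M}
    (hd : Set.range d ⊆ B) (h : SameDefinable L B s t) :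
    SameDefinable L A (Sum.elim s d) (Sum.elim t d) := fun S hS =>
  h {x | Sum.elim x d ∈ S} ((definable_fibre d hS).mono (Set.union_subset hAB hd))

/-- Only finitely many parameters from `B` occur; appending them to both tuples reduces the claim to
invariance over `A`. -/
theorem GlobalType.IsInvariantOver.large_iff_of_subset [Nonempty M] {p : GlobalType L M n}
    {A B : Set M} (hp : p.IsInvariantOver A) (hAB : A ⊆ B) {ι : Type} [Finite ι]
    {S : Set (Fin n ⊕ ι → M)} (hS : B.Definable L S) {s t : ι → M} (h : SameDefinable L B s t) :
    p.Large {x | Sum.elim x s ∈ S} ↔ p.Large {x | Sum.elim x t ∈ S} := by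
  obtain ⟨k, d, hd, T, hT, rfl⟩ := exists_definable_fibre_fin A hS
  have key (r : ι → M) : {x | Sum.elim x r ∈ {y : Fin n ⊕ ι → M | Sum.elim y d ∈ T}} =
      {x : Fin n → M | Sum.elim x (Sum.elim r d) ∈
        (fun g : Fin n ⊕ ι ⊕ Fin k → M => g ∘ Equiv.sumAssoc _ _ _) ⁻¹' T} := by
    ext x
    have : Sum.elim x (Sum.elim r d) ∘ Equiv.sumAssoc _ _ _ = Sum.elim (Sum.elim x r) d := by
      funext i; rcases i with (i | i) | i <;> rfl
    change Sum.elim (Sum.elim x r) d ∈ T ↔ Sum.elim x (Sum.elim r d) ∘ _ ∈ T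
    rw [this]
  rw [key, key]
  exact hp.large_iff (hT.preimage_comp _) (h.sumElim hAB hd)

/-! ### Saturation and existence of generic tuples -/

theorem IsMonster.exists_mem_of_finite_inter {κ : Cardinal.{w}}
    (hM : L.IsMonster M κ) {A : Set M} (hA : #A < κ) {k : ℕ} (F : Set (Set (Fin k → M)))
    (hF : ∀ S ∈ F, A.Definable L S)
    (hfin : ∀ F₀ ⊆ F, F₀.Finite → ∃ a, ∀ S ∈ F₀, a ∈ S) : ∃ a, ∀ S ∈ F, a ∈ S := by
  obtain ⟨a, ha⟩ := hM.saturated A hA k {φ | Set.ofPred φ.Realize ∈ F} (by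
    intro S₀ hS₀ hf
    obtain ⟨a, ha⟩ := hfin ((fun φ => Set.ofPred φ.Realize) '' S₀) (by
      rintro _ ⟨φ, hφ, rfl⟩
      exact hS₀ hφ) (hf.image _)
    exact ⟨a, fun φ hφ => ha _ ⟨φ, hφ, rfl⟩⟩)
  refine ⟨a, fun S hS => ?_⟩
  obtain ⟨φ, rfl⟩ := hF S hS
  exact ha φ hS

end

section

variable {L : Language.{u, v}} {M : Type w} [L.Structure M] {n : ℕ} {κ : Cardinal.{w}}

/-- Compactness with a type `D` and extra conditions `G`: finitely many members of `D` collapse to a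
single `Q`. -/
theorem IsMonster.exists_mem_of_inter_closed (hM : L.IsMonster M κ) {A : Set M} (hA : #A < κ)
    {k : ℕ} (D G : Set (Set (Fin k → M))) (hD : ∀ S ∈ D, A.Definable L S)
    (hG : ∀ S ∈ G, A.Definable L S) (huniv : Set.univ ∈ D)
    (hinter : ∀ S ∈ D, ∀ T ∈ D, S ∩ T ∈ D)
    (hfin : ∀ Q ∈ D, ∀ G₀ ⊆ G, G₀.Finite → ∃ a ∈ Q, ∀ S ∈ G₀, a ∈ S) :
    ∃ a, (∀ S ∈ D, a ∈ S) ∧ ∀ S ∈ G, a ∈ S := by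
  have hsInter : ∀ D₀ : Set (Set (Fin k → M)), D₀.Finite → D₀ ⊆ D → ⋂₀ D₀ ∈ D := by
    intro D₀ hf
    induction D₀, hf using Set.Finite.induction_on with
    | empty => intro _; rwa [Set.sInter_empty]
    | insert _ _ ih =>
      intro h
      rw [Set.sInter_insert]
      exact hinter _ (h (Set.mem_insert _ _)) _ (ih ((Set.subset_insert _ _).trans h))
  obtain ⟨a, ha⟩ := hM.exists_mem_of_finite_inter hA (D ∪ G)
    (fun S hS => hS.elim (hD S) (hG S)) (by
      intro F₀ hF₀ hf
      obtain ⟨a, haQ, haG⟩ := hfin (⋂₀ (F₀ ∩ D))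
        (hsInter _ (hf.subset Set.inter_subset_left) Set.inter_subset_right) (F₀ ∩ G)
        Set.inter_subset_right (hf.subset Set.inter_subset_left)
      refine ⟨a, fun S hS => ?_⟩
      rcases hF₀ hS with h | h
      · exact haQ S ⟨hS, h⟩
      · exact haG S ⟨hS, h⟩)
  exact ⟨a, fun S hS => ha S (Or.inl hS), fun S hS => ha S (Or.inr hS)⟩

theorem IsMonster.mk_union_lt (hM : L.IsMonster M κ) {A B : Set M} (hA : #A < κ) (hB : #B < κ) :
    #(A ∪ B : Set M) < κ :=
  (mk_union_le A B).trans_lt (add_lt_of_lt hM.aleph0_lt.le hA hB)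

theorem IsMonster.mk_lt_of_countable (hM : L.IsMonster M κ) {A : Set M} (hA : A.Countable) :
    #A < κ :=
  (mk_le_aleph0_iff.2 hA).trans_lt hM.aleph0_lt

namespace GlobalType

variable [Nonempty M] {p : GlobalType L M n} {A B : Set M}

theorem exists_generic_forall_mem (hM : L.IsMonster M κ) (hA : #A < κ) (hB : #B < κ)
    (G : Set (Set (Fin n → M))) (hG : ∀ S ∈ G, B.Definable L S)
    (hfin : ∀ Q, A.Definable L Q → p.Large Q → ∀ G₀ ⊆ G, G₀.Finite →
      ∃ a ∈ Q, ∀ S ∈ G₀, a ∈ S) :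
    ∃ a, p.Generic A a ∧ ∀ S ∈ G, a ∈ S := by
  obtain ⟨a, ha, haG⟩ := hM.exists_mem_of_inter_closed (hM.mk_union_lt hA hB)
    {S | A.Definable L S ∧ p.Large S} G (fun S hS => hS.1.mono Set.subset_union_left)
    (fun S hS => (hG S hS).mono Set.subset_union_right) ⟨Set.definable_univ, large_univ⟩
    (fun S hS T hT => ⟨hS.1.inter hT.1, hS.2.inter hT.2⟩)
    (fun Q hQ => hfin Q hQ.1 hQ.2)
  exact ⟨a, fun S hS hL => ha S ⟨hS, hL⟩, haG⟩

theorem exists_generic (hM : L.IsMonster M κ) (p : GlobalType L M n) (hA : #A < κ) :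
    ∃ a, p.Generic A a := by
  obtain ⟨a, ha, -⟩ := exists_generic_forall_mem (p := p) hM hA hA ∅ (by simp) (by
    intro Q _ hQ G₀ hG₀ _
    obtain ⟨a, ha⟩ := hQ.nonempty
    exact ⟨a, ha, fun S hS => (hG₀ hS).elim⟩)
  exact ⟨a, ha⟩

end GlobalType

/-! ### Morley sequences of length `ω` -/

/-- The entries of the first `k` tuples of a sequence. -/
def entriesBelow (a : ℕ → Fin n → M) (k : ℕ) : Set M :=
  {x | ∃ j < k, x ∈ Set.range (a j)}

theorem entriesBelow_succ (a : ℕ → Fin n → M) (k : ℕ) :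
    entriesBelow a (k + 1) = entriesBelow a k ∪ Set.range (a k) := by
  ext x
  simp only [entriesBelow, Set.mem_union, Set.mem_ofPred_eq]
  constructor
  · rintro ⟨j, hj, hx⟩
    rcases Nat.lt_succ_iff_lt_or_eq.1 hj with h | rfl
    · exact Or.inl ⟨j, h, hx⟩
    · exact Or.inr hx
  · rintro (⟨j, hj, hx⟩ | hx)
    · exact ⟨j, hj.trans (Nat.lt_succ_self k), hx⟩
    · exact ⟨k, Nat.lt_succ_self k, hx⟩

theorem entriesBelow_zero (a : ℕ → Fin n → M) : entriesBelow a 0 = ∅ := by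
  ext x
  simp [entriesBelow]

theorem entriesBelow_subset (a : ℕ → Fin n → M) (k : ℕ) :
    entriesBelow a k ⊆ ⋃ i, Set.range (a i) := by
  rintro x ⟨j, -, hx⟩
  exact Set.mem_iUnion.2 ⟨j, hx⟩

theorem countable_iUnion_range (a : ℕ → Fin n → M) : (⋃ i, Set.range (a i)).Countable :=
  Set.countable_iUnion fun _ => Set.countable_range _

theorem exists_seq_entriesBelow (r : Set M → Fin n → M) (E : Set M) :
    ∃ a : ℕ → Fin n → M, ∀ k, a k = r (E ∪ entriesBelow a k) := by
  -- The recursion runs on the accumulated parameter set, since the next term depends on nothing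
  -- else.
  let X : ℕ → Set M := fun k => Nat.rec E (fun _ Y => Y ∪ Set.range (r Y)) k
  have hX (k : ℕ) : X k = E ∪ entriesBelow (fun k => r (X k)) k := by
    induction k with
    | zero =>
      rw [entriesBelow_zero, Set.union_empty]
      rfl
    | succ k ih =>
      rw [entriesBelow_succ, ← Set.union_assoc, ← ih]
  exact ⟨fun k => r (X k), fun k => congrArg r (hX k)⟩

namespace GlobalType

variable {p : GlobalType L M n} {A B E : Set M} {a : ℕ → Fin n → M}

/-- A Morley sequence in `p` over `E` of length `ω`. -/
def IsMorley (p : GlobalType L M n) (E : Set M) (a : ℕ → Fin n → M) : Prop :=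
  ∀ k, p.Generic (E ∪ entriesBelow a k) (a k)

theorem IsMorley.mono (h : p.IsMorley B a) (hAB : A ⊆ B) : p.IsMorley A a :=
  fun k => (h k).mono (Set.union_subset_union_left _ hAB)

theorem IsMorley.generic (h : p.IsMorley A a) (k : ℕ) : p.Generic A (a k) :=
  (h k).mono Set.subset_union_left

variable [Nonempty M]

theorem exists_isMorley (hM : L.IsMonster M κ) (p : GlobalType L M n) (hE : #E < κ) :
    ∃ a, p.IsMorley E a := by
  have h (X : Set M) : ∃ a, #X < κ → p.Generic X a := by
    by_cases hX : #X < κ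
    · obtain ⟨a, ha⟩ := exists_generic hM p hX
      exact ⟨a, fun _ => ha⟩
    · exact ⟨fun _ => Classical.arbitrary M, fun h => (hX h).elim⟩
  choose r hr using h
  obtain ⟨a, ha⟩ := exists_seq_entriesBelow r E
  refine ⟨a, fun k => ?_⟩
  rw [ha k]
  exact hr _ (hM.mk_union_lt hE (hM.mk_lt_of_countable
    ((countable_iUnion_range a).mono (entriesBelow_subset a k))))

/-- Every formula over `M` holds at finitely many or at all but finitely many members of any
infinite Morley sequence in `p` over `A`. -/
def IsStableOver (p : GlobalType L M n) (A : Set M) : Prop :=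
  ∀ (α : Ordinal.{w}), Ordinal.omega0 ≤ α → ∀ a : Ordinal.{w} → Fin n → M,
      p.IsMorleySequence A α a → ∀ φ : L[[M]].Formula (Fin n),
        {i | i < α ∧ φ.Realize (a i)}.Finite ∨ {i | i < α ∧ ¬ φ.Realize (a i)}.Finite

/-- Otherwise a Morley continuation generic over the parameters of `S` lies outside `S`, and the
concatenation of length `ω + ω` meets both `S` and its complement infinitely often. -/
theorem IsStableOver.large_of_forall_mem (hM : L.IsMonster M κ) (hA : #A < κ)
    (hp : p.IsStableOver A) (ha : p.IsMorley A a) {S : Set (Fin n → M)} (hS : B.Definable L S)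
    (h : ∀ k, a k ∈ S) : p.Large S := by
  classical
  by_contra hn
  obtain ⟨B₀, -, hS⟩ := Set.definable_iff_finitely_definable.1 hS
  have hn := (large_compl hS).2 hn
  let U : Set M := ⋃ i, Set.range (a i)
  obtain ⟨c, hc⟩ := exists_isMorley hM p (E := A ∪ U ∪ B₀)
    (hM.mk_union_lt (hM.mk_union_lt hA (hM.mk_lt_of_countable (countable_iUnion_range a)))
      (hM.mk_lt_of_countable B₀.countable_toSet))
  let f : Ordinal.{w} → Fin n → M := fun i =>
    if h : ∃ k : ℕ, i = k then a h.choose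
    else if h : ∃ k : ℕ, i = Ordinal.omega0 + k then c h.choose else a 0
  have fa (k : ℕ) : f k = a k := by
    have hk : ∃ l : ℕ, (k : Ordinal.{w}) = l := ⟨k, rfl⟩
    simp only [f, dif_pos hk]
    exact congrArg a (Nat.cast_injective hk.choose_spec.symm)
  have fc (k : ℕ) : f (Ordinal.omega0 + k) = c k := by
    have hk' : ¬ ∃ l : ℕ, Ordinal.omega0.{w} + k = l := by
      rintro ⟨l, hl⟩
      exact absurd (Ordinal.natCast_lt_omega0 l) (hl ▸ not_lt.2 le_self_add)
    have hk : ∃ l : ℕ, Ordinal.omega0.{w} + k = Ordinal.omega0 + l := ⟨k, rfl⟩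
    simp only [f, dif_pos hk, dif_neg hk']
    exact congrArg c (Nat.cast_injective (add_left_cancel hk.choose_spec.symm))
  have hcases (i : Ordinal.{w}) (hi : i < Ordinal.omega0 + Ordinal.omega0) :
      (∃ k : ℕ, i = k) ∨ ∃ k : ℕ, i = Ordinal.omega0 + k := by
    rcases lt_or_ge i Ordinal.omega0 with h | h
    · exact Or.inl (Ordinal.lt_omega0.1 h)
    · obtain ⟨j, rfl⟩ := exists_add_of_le h
      obtain ⟨k, rfl⟩ := Ordinal.lt_omega0.1 (lt_of_add_lt_add_left hi)
      exact Or.inr ⟨k, rfl⟩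
  have hf : p.IsMorleySequence A (Ordinal.omega0 + Ordinal.omega0) f := by
    intro i hi
    rw [realizes_restrict_iff]
    rcases hcases i hi with ⟨k, rfl⟩ | ⟨k, rfl⟩
    · rw [fa]
      refine (ha k).mono (Set.union_subset_union_right _ ?_)
      rintro x ⟨j, hj, hx⟩
      obtain ⟨l, rfl⟩ := Ordinal.lt_omega0.1 (hj.trans (Ordinal.natCast_lt_omega0 k))
      rw [fa] at hx
      exact ⟨l, Nat.cast_lt.1 hj, hx⟩
    · rw [fc]
      refine (hc k).mono ?_
      rintro x (hx | ⟨j, hj, hx⟩)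
      · exact Or.inl (Or.inl (Or.inl hx))
      · rcases hcases j (hj.trans hi) with ⟨l, rfl⟩ | ⟨l, rfl⟩
        · rw [fa] at hx
          exact Or.inl (Or.inl (Or.inr (Set.mem_iUnion.2 ⟨l, hx⟩)))
        · rw [fc] at hx
          exact Or.inr ⟨l, Nat.cast_lt.1 (lt_of_add_lt_add_left hj), hx⟩
  obtain ⟨φ, hφ⟩ := exists_formula_of_definable hS
  rcases hp _ le_self_add f hf φ with h' | h'
  · have hmem (k : ℕ) : (k : Ordinal.{w}) ∈
        {i | i < Ordinal.omega0 + Ordinal.omega0 ∧ φ.Realize (f i)} := by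
      refine ⟨(Ordinal.natCast_lt_omega0 k).trans_le le_self_add, ?_⟩
      rw [fa, ← hφ]
      exact h k
    exact Set.infinite_of_injective_forall_mem Nat.cast_injective hmem h'
  · have hmem (k : ℕ) : Ordinal.omega0.{w} + (k : Ordinal.{w}) ∈
        {i | i < Ordinal.omega0 + Ordinal.omega0 ∧ ¬ φ.Realize (f i)} := by
      refine ⟨add_lt_add_right (Ordinal.natCast_lt_omega0 k) _, ?_⟩
      rw [fc, ← hφ]
      exact hc.generic k _ (hS.compl.mono Set.subset_union_right) hn
    exact Set.infinite_of_injective_forall_mem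
      (fun k l hkl => Nat.cast_injective (add_left_cancel hkl)) hmem h'

theorem Generic.sameDefinable {a b : Fin n → M} (ha : p.Generic A a) (hb : p.Generic A b) :
    SameDefinable L A a b := fun _ hS => (ha.mem_iff hS).trans (hb.mem_iff hS).symm

/-- Whether the last tuple meets a condition is decided by largeness of a fibre over the earlier
ones, and invariance makes that depend only on their type over `A`. -/
theorem IsMorley.sameDefinable {a b : ℕ → Fin n → M} (hp : p.IsInvariantOver A)
    (ha : p.IsMorley A a) (hb : p.IsMorley A b) (N : ℕ) :
    SameDefinable L A (fun i : Fin N × Fin n => a i.1 i.2) (fun i => b i.1 i.2) := by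
  induction N with
  | zero =>
    intro S _
    rw [Subsingleton.elim (fun i : Fin 0 × Fin n => a i.1 i.2) (fun i => b i.1 i.2)]
  | succ N ih =>
    intro S hS
    let g : Fin (N + 1) × Fin n → Fin n ⊕ (Fin N × Fin n) := fun i =>
      Fin.lastCases (motive := fun _ => Fin n ⊕ (Fin N × Fin n)) (Sum.inl i.2)
        (fun j => Sum.inr (j, i.2)) i.1
    have key (c : ℕ → Fin n → M) (hc : p.IsMorley A c) :
        (fun i : Fin (N + 1) × Fin n => c i.1 i.2) ∈ S ↔
          p.Large {x | Sum.elim x (fun i : Fin N × Fin n => c i.1 i.2) ∈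
            (fun h : Fin n ⊕ (Fin N × Fin n) → M => h ∘ g) ⁻¹' S} := by
      rw [← (hc N).mem_iff ((definable_fibre _ (hS.preimage_comp g)).mono ?_)]
      · have : Sum.elim (c N) (fun i : Fin N × Fin n => c i.1 i.2) ∘ g =
            fun i : Fin (N + 1) × Fin n => c i.1 i.2 := by
          funext ⟨i, j⟩
          refine Fin.lastCases ?_ (fun i => ?_) i <;> simp [g]
        change _ ↔ Sum.elim (c N) (fun i : Fin N × Fin n => c i.1 i.2) ∘ g ∈ S
        rw [this]
      · refine Set.union_subset_union_right _ ?_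
        rintro _ ⟨⟨i, j⟩, rfl⟩
        exact ⟨i, i.2, j, rfl⟩
    rw [key a ha, key b hb]
    exact hp.large_iff (hS.preimage_comp g) ih

end GlobalType

end

/-! ### Descent of isolation -/

section

variable {L : Language.{u, v}} {M : Type w} [L.Structure M] {n : ℕ} {κ : Cardinal.{w}}

namespace GlobalType

/-- Some large `A`-definable set consists of realizations of `p` restricted to `A`. -/
def IsIsolatedOver (p : GlobalType L M n) (A : Set M) : Prop :=
  ∃ S, A.Definable L S ∧ p.Large S ∧ ∀ a ∈ S, p.Generic A a

variable [Nonempty M] {p : GlobalType L M n} {A A₀ B C : Set M}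

/-- Isolation of a generically stable type descends along a realization of it. -/
theorem IsIsolatedOver.of_union_range (hM : L.IsMonster M κ) (hp : p.IsInvariantOver A)
    (hAC : A ⊆ C) (hC : #C < κ) (hA₀ : #A₀ < κ) (hst : p.IsStableOver A₀) {a : Fin n → M}
    (ha : p.Generic C a) (hiso : p.IsIsolatedOver (C ∪ Set.range a)) : p.IsIsolatedOver C := by
  obtain ⟨S, hS, hSL, hSg⟩ := hiso
  obtain ⟨Θ, hΘ, rfl⟩ := exists_definable_fibre hS
  have hΘlarge {c : Fin n → M} (hc : p.Generic C c) : p.Large {x | Sum.elim x c ∈ Θ} :=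
    (hp.large_iff_of_subset hAC hΘ (ha.sameDefinable hc)).1 hSL
  have hΘgen {c e : Fin n → M} (hc : p.Generic C c) (he : Sum.elim e c ∈ Θ) :
      p.Generic C e := by
    intro Q hQ hQL
    -- "Every `x` with `Θ(x, z)` lies in `Q`" is a `C`-definable condition on `z` that holds at `a`,
    -- hence at `c`.
    let W : Set (Fin n ⊕ Fin n → M) := ((fun g => g ∘ Sum.swap) ⁻¹' Θ)ᶜ ∪
      ((fun g => g ∘ Sum.inr) ⁻¹' Q)
    have hW : C.Definable L W := (hΘ.preimage_comp _).compl.union (hQ.preimage_comp _)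
    have hswap (z x : Fin n → M) : Sum.elim z x ∈ W ↔ (Sum.elim x z ∈ Θ → x ∈ Q) := by
      have : Sum.elim z x ∘ Sum.swap = Sum.elim x z := by
        funext i; cases i <;> rfl
      change (¬ Sum.elim z x ∘ Sum.swap ∈ Θ ∨ x ∈ Q) ↔ _
      rw [this, imp_iff_not_or]
    have haW : a ∈ {z | ∀ x, Sum.elim z x ∈ W} := fun x =>
      (hswap a x).2 fun hx => (hSg x hx).mono Set.subset_union_left Q hQ hQL
    have hcW := (ha.sameDefinable hc _ hW.forall_of_finite).1 haW
    exact (hswap c e).1 (hcW e) he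
  obtain ⟨b, hb⟩ := exists_isMorley hM p (E := C ∪ A₀) (hM.mk_union_lt hC hA₀)
  have hbC (k : ℕ) : p.Generic C (b k) := (hb.generic k).mono Set.subset_union_left
  let U : Set M := ⋃ i, Set.range (b i)
  have hU : #U < κ := hM.mk_lt_of_countable (countable_iUnion_range b)
  have hlarge {S : Set (Fin n → M)} {B : Set M} (hS : B.Definable L S)
      (h : ∀ k, b k ∈ S) : p.Large S :=
    hst.large_of_forall_mem hM hA₀ (hb.mono Set.subset_union_right) hS h
  by_contra hn
  -- Each large `Q` over `C` has a point that is not generic over `C`. By `hΘgen` it avoids all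
  -- fibres `Θ(x, b k)` at once.
  obtain ⟨e, he, heb⟩ := exists_generic_forall_mem (p := p) hM hC (hM.mk_union_lt hC hU)
    (Set.range fun k => {x | Sum.elim x (b k) ∈ Θ}ᶜ) (by
      rintro _ ⟨k, rfl⟩
      exact ((definable_fibre _ hΘ).compl).mono
        (Set.union_subset_union_right _ (Set.subset_iUnion (fun i => Set.range (b i)) k))) (by
      intro Q hQ hQL G₀ hG₀ _
      have : ∃ e ∈ Q, ¬ p.Generic C e := by
        by_contra! h
        exact hn ⟨Q, hQ, hQL, h⟩
      obtain ⟨e, heQ, he⟩ := this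
      refine ⟨e, heQ, fun S hS => ?_⟩
      obtain ⟨k, rfl⟩ := hG₀ hS
      exact fun h => he (hΘgen (hbC k) h))
  have heb (k : ℕ) : Sum.elim e (b k) ∉ Θ := heb _ ⟨k, rfl⟩
  let Θ' : Set (Fin n ⊕ Fin n → M) := ((fun g => g ∘ Sum.swap) ⁻¹' Θ)ᶜ
  have hΘ' : C.Definable L Θ' := (hΘ.preimage_comp _).compl
  have hswap (z x : Fin n → M) : Sum.elim z x ∈ Θ' ↔ Sum.elim x z ∉ Θ := by
    have : Sum.elim z x ∘ Sum.swap = Sum.elim x z := by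
      funext i; cases i <;> rfl
    change ¬ Sum.elim z x ∘ Sum.swap ∈ Θ ↔ _
    rw [this]
  -- Symmetry argument: `¬Θ(e, z)` is in `p(z)` by stability, and so is `¬Θ(b k, z)` by invariance.
  -- Hence `c` generic over all `b k` gives `¬Θ(b k, c)`, and stability puts `¬Θ(x, c)` in `p`,
  -- against `hΘlarge`.
  have heL : p.Large {z | Sum.elim z e ∈ Θ'} :=
    hlarge (definable_fibre e hΘ') fun k => (hswap _ _).2 (heb k)
  obtain ⟨c, hc⟩ := exists_generic hM p (hM.mk_union_lt hC hU)
  have hcC : p.Generic C c := hc.mono Set.subset_union_left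
  have hbc (k : ℕ) : b k ∈ {x | Sum.elim x c ∈ Θ}ᶜ := by
    refine (hswap c (b k)).1 ?_
    exact hc {z | Sum.elim z (b k) ∈ Θ'} ((definable_fibre _ hΘ').mono
      (Set.union_subset_union_right _ (Set.subset_iUnion (fun i => Set.range (b i)) k)))
      ((hp.large_iff_of_subset hAC hΘ' (he.sameDefinable (hbC k))).1 heL)
  exact (large_compl (definable_fibre c hΘ)).1 (hlarge (definable_fibre c hΘ).compl hbc)
    (hΘlarge hcC)

/-- A Morley sequence meets every definable set that is large for the type. -/
theorem IsMorley.exists_mem (hM : L.IsMonster M κ) (hp : p.IsInvariantOver A) (hA : #A < κ)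
    (hA₀ : #A₀ < κ) (hst : p.IsStableOver A₀) {a : ℕ → Fin n → M} (ha : p.IsMorley A a)
    {S : Set (Fin n → M)} (hS : B.Definable L S) (hSL : p.Large S) : ∃ k, a k ∈ S := by
  obtain ⟨m, b, -, Θ, hΘ, rfl⟩ := exists_definable_fibre_fin A hS
  by_contra! hn
  -- Stability is available only over `A₀`, while `a` is Morley only over `A`. So `a` is replaced by
  -- `c`, and `b` by some `b'` of the same type over `A` such that `c` avoids the fibre over `b'`.
  obtain ⟨c, hc⟩ := exists_isMorley hM p (E := A ∪ A₀) (hM.mk_union_lt hA hA₀)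
  have hcA : p.IsMorley A c := hc.mono Set.subset_union_left
  let U : Set M := ⋃ i, Set.range (c i)
  have hU : #U < κ := hM.mk_lt_of_countable (countable_iUnion_range c)
  let Ξ : Set (Fin m ⊕ Fin n → M) := ((fun g => g ∘ Sum.swap) ⁻¹' Θ)ᶜ
  have hΞ : A.Definable L Ξ := (hΘ.preimage_comp _).compl
  have hswap (y : Fin m → M) (x : Fin n → M) : Sum.elim y x ∈ Ξ ↔ Sum.elim x y ∉ Θ := by
    have : Sum.elim y x ∘ Sum.swap = Sum.elim x y := by
      funext i; cases i <;> rfl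
    change ¬ Sum.elim y x ∘ Sum.swap ∈ Θ ↔ _
    rw [this]
  let G : ℕ → Set (Fin m → M) := fun k => {y | Sum.elim y (c k) ∈ Ξ}
  obtain ⟨b', hb', hcb'⟩ := hM.exists_mem_of_inter_closed (hM.mk_union_lt hA hU)
    {T | A.Definable L T ∧ b ∈ T} (Set.range G)
    (fun T hT => hT.1.mono Set.subset_union_left) (by
      rintro _ ⟨k, rfl⟩
      exact (definable_fibre _ hΞ).mono
        (Set.union_subset_union_right _ (Set.subset_iUnion (fun i => Set.range (c i)) k)))
    ⟨Set.definable_univ, trivial⟩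
    (fun S hS T hT => ⟨hS.1.inter hT.1, hS.2, hT.2⟩) (by
      rintro Q ⟨hQ, hbQ⟩ G₀ hG₀ hfin
      have hN : ∃ N : ℕ, ∀ T ∈ G₀, ∃ k < N, T = G k := by
        choose! i hi using fun T (hT : T ∈ G₀) => hG₀ hT
        obtain ⟨N, hN⟩ := (hfin.image i).bddAbove
        exact ⟨N + 1, fun T hT => ⟨i T, Nat.lt_succ_of_le (hN ⟨T, hT, rfl⟩), (hi T hT).symm⟩⟩
      obtain ⟨N, hN⟩ := hN
      let V : Set ((Fin N × Fin n) ⊕ Fin m → M) := ((fun g => g ∘ Sum.inr) ⁻¹' Q) ∩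
        ⋂ k : Fin N, ((fun g => g ∘ Sum.elim Sum.inr fun j => Sum.inl (k, j)) ⁻¹' Ξ)
      have hV : A.Definable L V := (hQ.preimage_comp _).inter
        (Set.definable_iInter_of_finite fun k => hΞ.preimage_comp _)
      have hVmem (d : ℕ → Fin n → M) (y : Fin m → M) :
          Sum.elim (fun i : Fin N × Fin n => d i.1 i.2) y ∈ V ↔
            y ∈ Q ∧ ∀ k : Fin N, Sum.elim y (d k) ∈ Ξ := by
        have (k : Fin N) : (Sum.elim (fun i : Fin N × Fin n => d i.1 i.2) y ∘
            Sum.elim Sum.inr fun j => Sum.inl (k, j)) = Sum.elim y (d k) := by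
          funext i; cases i <;> rfl
        simp only [V, Set.mem_inter_iff, Set.mem_iInter, Set.mem_preimage, this]
        rfl
      -- Finite satisfiability: `b` witnesses an `A`-definable property of the first `N` terms of
      -- `a`, which passes to those of `c`.
      have haV : (fun i : Fin N × Fin n => a i.1 i.2) ∈ {v | ∃ y, Sum.elim v y ∈ V} :=
        ⟨b, (hVmem a b).2 ⟨hbQ, fun k => (hswap _ _).2 (hn k)⟩⟩
      obtain ⟨y, hy⟩ := (ha.sameDefinable hp hcA N _ hV.exists_of_finite).1 haV
      obtain ⟨hyQ, hy⟩ := (hVmem c y).1 hy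
      refine ⟨y, hyQ, fun T hT => ?_⟩
      obtain ⟨k, hk, rfl⟩ := hN T hT
      exact hy ⟨k, hk⟩)
  have hbb' : SameDefinable L A b b' := by
    intro T hT
    refine ⟨fun h => hb' T ⟨hT, h⟩, fun h => ?_⟩
    by_contra hb
    exact hb' Tᶜ ⟨hT.compl, hb⟩ h
  have hL : p.Large {x | Sum.elim x b' ∈ Θ}ᶜ :=
    hst.large_of_forall_mem hM hA₀ (hc.mono Set.subset_union_right)
      (definable_fibre b' hΘ).compl fun k => (hswap _ _).1 (hcb' _ ⟨k, rfl⟩)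
  exact (large_compl (definable_fibre b' hΘ)).1 hL ((hp.large_iff hΘ hbb').1 hSL)

theorem IsRegularOver.isIsolatedOver_of_subset (hM : L.IsMonster M κ) (hA : #A < κ)
    (hA₀ : #A₀ < κ) (hst : p.IsStableOver A₀) (hreg : p.IsRegularOver κ A) (hAB : A ⊆ B)
    (hB : #B < κ) (hiso : p.IsIsolatedOver B) : p.IsIsolatedOver A := by
  obtain ⟨-, hp, hreg⟩ := hreg
  obtain ⟨S, hS, hSL, hSg⟩ := hiso
  by_contra hn
  let Good : Set M → Prop := fun X => A ⊆ X ∧ #X < κ ∧ ¬ p.IsIsolatedOver X ∧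
    ∀ c, p.Generic B c → p.Generic (B ∪ X) c
  have hext (X : Set M) : ∃ a, Good X → p.Generic X a ∧ a ∉ S := by
    by_cases hX : Good X
    · obtain ⟨hAX, hXκ, hXiso, hXB⟩ := hX
      obtain ⟨a, ha, haS⟩ := exists_generic_forall_mem (p := p) hM hXκ hB {Sᶜ}
        (by rintro _ rfl; exact hS.compl) (by
          intro Q hQ hQL G₀ hG₀ _
          have : ∃ a ∈ Q, a ∉ S := by
            by_contra! h
            exact hXiso ⟨Q, hQ, hQL, fun a ha =>
              (hXB a (hSg a (h a ha))).mono Set.subset_union_right⟩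
          obtain ⟨a, haQ, haS⟩ := this
          refine ⟨a, haQ, fun T hT => ?_⟩
          rw [hG₀ hT]
          exact haS)
      exact ⟨a, fun _ => ⟨ha, haS _ rfl⟩⟩
    · exact ⟨fun _ => Classical.arbitrary M, fun h => (hX h).elim⟩
  choose r hr using hext
  obtain ⟨a, ha⟩ := exists_seq_entriesBelow r A
  have hgood (k : ℕ) : Good (A ∪ entriesBelow a k) := by
    induction k with
    | zero =>
      rw [entriesBelow_zero, Set.union_empty]
      refine ⟨subset_rfl, hA, hn, fun c hc => ?_⟩
      rwa [Set.union_eq_self_of_subset_right hAB]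
    | succ k ih =>
      obtain ⟨hg, hgS⟩ := hr _ ih
      rw [← ha k] at hg hgS
      obtain ⟨hAX, hXκ, hXiso, hXB⟩ := ih
      rw [entriesBelow_succ, ← Set.union_assoc]
      refine ⟨hAX.trans Set.subset_union_left,
        hM.mk_union_lt hXκ (hM.mk_lt_of_countable (Set.countable_range _)),
        fun h => hXiso (h.of_union_range hM hp hAX hXκ hA₀ hst hg), fun c hc => ?_⟩
      rw [← Set.union_assoc]
      -- The first alternative of regularity would place `a k` in `S`.
      rcases hreg (B ∪ (A ∪ entriesBelow a k)) (hAB.trans Set.subset_union_left)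
        (hM.mk_union_lt hB hXκ) (a k) (realizes_restrict_iff.2 (hg.mono hAX)) with h | h
      · exact (hgS (((realizes_restrict_iff.1 h).mono Set.subset_union_left) S hS hSL)).elim
      · exact realizes_restrict_iff.1 (h c (realizes_restrict_iff.2 (hXB c hc)))
  have hmorley : p.IsMorley A a := fun k => by
    rw [ha k]
    exact (hr _ (hgood k)).1
  obtain ⟨k, hk⟩ := hmorley.exists_mem hM hp hA hA₀ hst hS hSL
  rw [ha k] at hk
  exact (hr _ (hgood k)).2 hk

end GlobalType

end

end FirstOrder.Language

theorem mainTheorem7 {L : FirstOrder.Language.{u, v}} {M : Type w} [L.Structure M] [Nonempty M]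
    {κ : Cardinal.{w}} (hM : L.IsMonster M κ) {n : ℕ}
    (p : FirstOrder.Language.GlobalType L M n) (A : Set M) (hA : Cardinal.mk A < κ)
    (hgs : p.IsGenericallyStable κ) (hreg : p.IsRegularOver κ A)
    (hiso : ¬ FirstOrder.Language.IsIsolatedType (p.restrict A)) :
    ∀ B : Set M, A ⊆ B → Cardinal.mk B < κ →
      ¬ FirstOrder.Language.IsIsolatedType (p.restrict B) := by
  intro B hAB hB hBiso
  obtain ⟨-, A₀, hA₀, -, hst⟩ := hgs
  exact hiso (FirstOrder.Language.GlobalType.isIsolatedType_restrict_iff.2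
    (hreg.isIsolatedOver_of_subset hM hA hA₀ hst hAB hB
      (FirstOrder.Language.GlobalType.isIsolatedType_restrict_iff.1 hBiso)))
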